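/- **Model.** An anonymous dynamic network consists of a finite set $V$ of $n\ge 1$ agents and undirected multigraphs $G_1,G_2,\dots$ on $V$; it is connected if every $G_t$ is connected. Every agent has an input that it can always read. In round $t\ge1$ every agent sends one message, a function of its input and its state, through all its incident links in $G_t$, receives the multiset of its neighbors' messages, updates its state as a function of its input, its state and this multiset, and returns an output that is a function of its input and its new state; the functions are the same for all agents and do not depend on $n$. **Views.** Views over an input set $I$ are (up to isomorphism) defined recursively. A view of height $1$ is a root with a single child, labeled by an element of $I$. A view of height $k+1$ is obtained from a view of height $k$ and a finite multiset of views of height $k$: match-and-merge the latter into the former, add a new child, labeled by an element of $I$, to the bottom node of the former (this is the new bottom node), and add a red edge to it from the bottom node of each view of the multiset (with multiplicity). So the height is the number of levels $L_0,\dots,L_{k-1}$ below the root. *Chopping* a view of height at least $2$ deletes level $L_0$, attaches the nodes of $L_1$ to the root, and merges nodes with isomorphic sub-views, level by level, adding the multiplicities of their outgoing red edges. **Memory.** The memory of an agent either encodes a pair $(\mathcal V,b)$ of a view and a flag $b\in\{0,1\}$, or it is ill-formed. The *garbage coefficient* of an agent is the height of the view encoded by its initial memory, or $0$ if that memory is ill-formed.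 **Theorem.** For every set $I$ of inputs there is an algorithm, independent of $n$, with the following two properties. 1. In every round, an agent with input $x$ whose memory is ill-formed first resets it to the pair consisting of the view of height $1$ with label $x$ and the flag $0$. It sends its pair to all its neighbors. Among its own pair and the received ones it selects a pair $(\mathcal V^*,b^*)$ whose view has minimum height, chops its own view and all received views down to this height, and forms from them its new view, with new bottom label $x$. Its new flag is $1-b^*$; if this is $0$, the new view is chopped once. (So views are chopped once every two rounds, synchronized by the flags.) 2. It is self-stabilizing and universal: in every connected anonymous dynamic network of any size $n\ge 1$, for all inputs and all initial memories of the agents, at the end of every round $t\ge\max\{4n-2h,\,2h\}$ every agent outputs the Input Frequency function (which assigns to each $x\in I$ the fraction of agents whose input is $x$), where $h$ is the minimum garbage coefficient of all agents. -/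

import Mathlib

universe u v w

/-! ### Anonymous dynamic networks -/

/-- A finite undirected multigraph: `mult p q` is the number of links between `p` and `q`
(parallel links and self-loops are allowed). -/
structure Multigraph (V : Type v) where
  mult : V → V → ℕ
  symm : ∀ p q, mult p q = mult q p

namespace Multigraph

variable {V : Type v}

/-- The multigraph is connected (in particular it has at least one vertex). -/
def Connected (G : Multigraph V) : Prop :=
  (SimpleGraph.fromRel fun p q => 0 < G.mult p q).Connected

/-- The multiset of messages received by `p` if every agent `q` sends `msg q` through all its
incident links. -/
def received [Fintype V] {M : Type w} (G : Multigraph V) (msg : V → M) (p : V) : Multiset M :=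
  ∑ q, G.mult p q • ({msg q} : Multiset M)

end Multigraph

/-- A local algorithm, the same for all (anonymous) agents, for inputs in `I`, internal states in
`S`, messages in `M` and outputs in `O`. An agent can always read its own input. -/
structure Algorithm (I : Type*) (S : Type*) (M : Type*) (O : Type*) where
  /-- the message sent to all neighbors -/
  send : I → S → M
  /-- the new state, from the current state and the multiset of received messages -/
  step : I → S → Multiset M → S
  /-- the output returned at the end of a round -/
  out : I → S → O

/-- The state of every agent at the end of round `t`, if the initial states are `s₀`; here `G t` is
the communication graph of round `t + 1`. -/
def Algorithm.run {I S M O : Type*} (A : Algorithm I S M O) {V : Type v} [Fintype V]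
    (G : ℕ → Multigraph V) (input : V → I) (s₀ : V → S) : ℕ → V → S
  | 0 => s₀
  | t + 1 => fun p => A.step (input p) (A.run G input s₀ t p)
      ((G t).received (fun q => A.send (input q) (A.run G input s₀ t q)) p)

/-- The Input Frequency function: the fraction of agents that have each input value. -/
noncomputable def inputFrequency {V : Type v} {I : Type u} (input : V → I) : I → ℚ :=
  fun x => (Nat.card {p : V // input p = x} : ℚ) / (Nat.card V : ℚ)

/-! ### Views of history trees -/

/-- Views of history trees whose bottom node lies in level `L_k`, up to isomorphism.

A view is determined by its bottom node's label, the sub-view at the parent of the bottom node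
(along the black edge), and the multiset of the sub-views at the sources of the red edges entering
the bottom node (with their multiplicities). The nodes of level `L_i` are the distinct sub-views of
index `i` that occur, since nodes with isomorphic sub-views are merged; the node of a view with
index `0` is attached to the root, which is left implicit. -/
def LevelView (I : Type u) : ℕ → Type u
  | 0 => I
  | k + 1 => I × LevelView I k × Multiset (LevelView I k)

namespace LevelView

variable {I : Type u}

/-- Update of the view `own` of an agent with input `x`: the bottom node gets a child labeled `x`,
the views in `rec` are match-and-merged into `own`, and each of their bottom nodes gets a red edge
to the new bottom node. -/
def extend {k : ℕ} (x : I) (own : LevelView I k) (rec : Multiset (LevelView I k)) :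
    LevelView I (k + 1) :=
  (x, own, rec)

/-- The chop operation: level `L_0` is deleted, the nodes of `L_1` are attached to the root, and
then nodes with isomorphic sub-views are merged, adding the multiplicities of their outgoing red
edges (this is what mapping a multiset of sub-views does). -/
def chop : {k : ℕ} → LevelView I (k + 1) → LevelView I k
  | 0, (x, _, _) => x
  | _ + 1, (x, own, rec) => (x, chop own, rec.map chop)

/-- Chop a view repeatedly, until its bottom node lies in level `L_k`. -/
def trim {k m : ℕ} (h : k ≤ m) : LevelView I m → LevelView I k :=
  Nat.leRec (motive := fun m _ => LevelView I m → LevelView I k)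
    (fun V => V) (fun _ _ f V => f (chop V)) h

end LevelView

/-- A (well-formed) view of a history tree, of any height. -/
def View (I : Type u) : Type u := Σ k, LevelView I k

namespace View

variable {I : Type u}

/-- The height of a view: the length of a path from the root to the bottom node, that is, the
number of its levels `L_0, …, L_k`. -/
def height (V : View I) : ℕ := V.1 + 1

/-- The view with two nodes: a root with a single child labeled `x`. -/
def initial (x : I) : View I := ⟨0, x⟩

end View

/-! ### The view-chopping algorithms -/

/-- The possible contents of an agent's memory: either a well-formed view together with a binary
flag, or something in `J` that does not encode such a pair. -/
abbrev Memory (I : Type u) (J : Type w) := (View I × Bool) ⊕ J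

namespace Memory

variable {I : Type u} {J : Type w}

/-- The garbage coefficient of an agent with the given initial memory. -/
def garbage : Memory I J → ℕ
  | .inl (V, _) => V.height
  | .inr _ => 0

/-- An ill-formed memory of an agent with input `x` is reset to the two-node view with flag `0`. -/
def reset (x : I) : Memory I J → View I × Bool
  | .inl P => P
  | .inr _ => (View.initial x, false)

end Memory

/-- The algorithm works by chopping views once every two rounds, synchronized by a binary flag.

Every agent first resets its memory if it is ill-formed, and sends its pair (view, flag) to all its
neighbors. It then selects a pair `(V, b)` whose view has minimum height among its own pair and the
received ones, chops its own view and all received views to that height, and updates its own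
view with the received ones. Its new flag is `1 - b`, and if this is `0` the resulting view is
chopped once. (Flags: `false` is `0`, `true` is `1`.) -/
def Algorithm.ChopsViews {I : Type u} {J : Type w} {O : Type*}
    (A : Algorithm I (Memory I J) (View I × Bool) O) : Prop :=
  (∀ x s, A.send x s = s.reset x) ∧
  ∀ (x : I) (s : Memory I J) (rec : Multiset (View I × Bool)),
    ∃ (V : View I) (b : Bool), (V, b) ∈ s.reset x ::ₘ rec ∧
      ∃ (hown : V.1 ≤ (s.reset x).1.1) (hrec : ∀ P ∈ rec, V.1 ≤ P.1.1),
        let new : LevelView I (V.1 + 1) := LevelView.extend x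
          (LevelView.trim hown (s.reset x).1.2)
          (rec.pmap (fun P (h : V.1 ≤ P.1.1) => LevelView.trim h P.1.2) hrec)
        A.step x s rec = .inl (match b with
          | false => (⟨V.1 + 1, new⟩, true)
          | true => (⟨V.1, new.chop⟩, false))

/-!
The sub-views of height `i + 1` that occur in a network partition the agents into classes, and
these partitions get finer as `i` grows. A network with `n` agents therefore has a level
`i < n` at which no class splits. There the view of an agent determines the multiset of the views
that it receives, so counting the links between two classes from either side gives the ratio of
their sizes; by connectivity all ratios are determined. After `n - 1` more rounds these data have
spread to every agent, so a view of height at least `2 n` determines the input frequencies.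

For stabilization, measure the progress of an agent with view of height `l` and flag `b` by
`2 l - b`. Each round, an agent moves to one more than the least progress among its own and its
neighbors'. Hence the minimum progress grows by exactly one per round, and it spreads to all agents
within `n - 1` rounds, which pins the height to about `h + t / 2`. Every round adds one fresh level
at the bottom, so after `t` rounds the last `t` levels are free of garbage; once the height is
between `2 n` and `t`, the view is a view of a genuine network, namely of the last rounds.
-/

/-! ### Connected multigraphs -/

namespace Multigraph

variable {V : Type v}

/-- In a round with communication graph `G`, agent `p` has access to the message of agent `q`:
either it is its own message or the two are linked. -/
def Hears (G : Multigraph V) (p q : V) : Prop :=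
  p = q ∨ 0 < G.mult p q

theorem Connected.eq_univ_of_forall_hears {G : Multigraph V} (hG : G.Connected) {R : Set V}
    (hne : R.Nonempty) (hR : ∀ p q, G.Hears p q → q ∈ R → p ∈ R) : R = Set.univ := by
  obtain ⟨q, hq⟩ := hne
  refine Set.eq_univ_of_forall fun p => by_contra fun hp => ?_
  obtain ⟨walk⟩ := hG.preconnected q p
  obtain ⟨⟨⟨a, b⟩, hab⟩, -, ha, hb⟩ := walk.exists_boundary_dart R hq hp
  have hlink : 0 < G.mult b a := by
    rw [SimpleGraph.fromRel_adj, G.symm a b, or_self] at hab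
    exact hab.2
  exact hb (hR b a (Or.inr hlink) ha)

variable [Fintype V] {M : Type*}

theorem eq_univ_of_spread {G : ℕ → Multigraph V} (hG : ∀ t, (G t).Connected) {R : ℕ → Set V}
    (hne : (R 0).Nonempty) (hR : ∀ t p q, (G t).Hears p q → q ∈ R t → p ∈ R (t + 1))
    {t : ℕ} (ht : Fintype.card V ≤ t + 1) : R t = Set.univ := by
  have hmono : ∀ t, R t ⊆ R (t + 1) := fun t p => hR t p p (Or.inl rfl)
  have hcard : ∀ t, R t = Set.univ ∨ t + 1 ≤ (R t).ncard := by
    intro t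
    induction t with
    | zero => exact Or.inr ((Set.ncard_pos (Set.toFinite _)).2 hne)
    | succ t ih =>
      rcases ih with huniv | hlt
      · exact Or.inl (Set.univ_subset_iff.1 (huniv ▸ hmono t))
      rcases (hmono t).eq_or_ssubset with heq | hss
      · have hne : (R t).Nonempty := (Set.ncard_pos (Set.toFinite _)).1 (by omega)
        refine Or.inl (heq ▸ (hG t).eq_univ_of_forall_hears hne fun p q hpq hq => ?_)
        exact heq ▸ hR t p q hpq hq
      · exact Or.inr (hlt.trans_lt (Set.ncard_lt_ncard hss))
  refine (hcard t).elim id fun h => Set.eq_of_subset_of_ncard_le (Set.subset_univ _) ?_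
  rw [Set.ncard_univ, Nat.card_eq_fintype_card]
  exact ht.trans h

theorem received_eq_map (G : Multigraph V) (msg : V → M) (p : V) :
    G.received msg p = (G.received id p).map msg := by
  rw [received, received, ← Multiset.coe_mapAddMonoidHom, map_sum]
  simp [map_nsmul]

theorem mem_received {G : Multigraph V} {msg : V → M} {p : V} {m : M} :
    m ∈ G.received msg p ↔ ∃ q, 0 < G.mult p q ∧ msg q = m := by
  simp [received, Multiset.mem_sum, Multiset.mem_nsmul, Nat.pos_iff_ne_zero, eq_comm]

theorem mem_cons_received {G : Multigraph V} {msg : V → M} {p : V} {m : M} :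
    m ∈ msg p ::ₘ G.received msg p ↔ ∃ q, G.Hears p q ∧ msg q = m := by
  simp [Hears, mem_received, or_and_right, exists_or, eq_comm]

theorem count_received [DecidableEq M] (G : Multigraph V) (msg : V → M) (p : V) (m : M) :
    (G.received msg p).count m = ∑ q with msg q = m, G.mult p q := by
  simp [received, Multiset.count_sum', Multiset.count_nsmul, Multiset.count_singleton,
    Finset.sum_filter, eq_comm]

theorem pmap_received {N : Type*} {P : M → Prop} {G : Multigraph V} {msg : V → M} {p : V}
    {f : ∀ m, P m → N} {g : V → N} (H : ∀ m ∈ G.received msg p, P m)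
    (hfg : ∀ q (h : P (msg q)), f (msg q) h = g q) :
    (G.received msg p).pmap f H = G.received g p := by
  rw [received_eq_map G g]
  revert H
  rw [received_eq_map]
  induction G.received id p using Multiset.induction with
  | empty => exact fun _ => rfl
  | cons q R ih =>
    intro H
    simp only [Multiset.map_cons, Multiset.pmap_cons, hfg, ih]

end Multigraph

/-! ### Class sizes -/

section Census

variable {V : Type v} [Fintype V] {V' : Type*} [Fintype V'] {X : Type*}

/-- The multiset of the values of `f` at all agents, which records the size of each class of agents
that `f` does not distinguish. -/
def census (f : V → X) : Multiset X :=
  Finset.univ.val.map f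

theorem mem_census {f : V → X} {x : X} : x ∈ census f ↔ x ∈ Set.range f := by
  simp [census]

theorem count_census [DecidableEq X] (f : V → X) (x : X) :
    (census f).count x = Finset.card {p | f p = x} := by
  simp only [census, Multiset.count_map, eq_comm (a := x)]
  rfl

theorem inputFrequency_apply {I : Type u} [DecidableEq I] (input : V → I) (x : I) :
    inputFrequency input x = (census input).count x / (census input).card := by
  rw [inputFrequency, Nat.card_eq_fintype_card, Nat.card_eq_fintype_card, Fintype.card_subtype,
    ← count_census, census, Multiset.card_map]
  rfl

theorem inputFrequency_eq_of_nsmul_census_eq {I : Type u} {input : V → I} {input' : V' → I}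
    {a b : ℕ} (ha : a ≠ 0) (hb : b ≠ 0) (h : a • census input = b • census input') :
    inputFrequency input = inputFrequency input' := by
  classical
  funext x
  have hcount := congrArg (Multiset.count x) h
  have hcard := congrArg Multiset.card h
  simp only [Multiset.count_nsmul, Multiset.card_nsmul] at hcount hcard
  have ha' : (a : ℚ) ≠ 0 := Nat.cast_ne_zero.2 ha
  have hb' : (b : ℚ) ≠ 0 := Nat.cast_ne_zero.2 hb
  rw [inputFrequency_apply, inputFrequency_apply, ← mul_div_mul_left _ _ ha',
    ← mul_div_mul_left ((census input').count x : ℚ) _ hb']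
  exact_mod_cast congrArg₂ (fun m n : ℕ => (m / n : ℚ)) hcount hcard

namespace Multigraph

/-- Both sides count the links between class `x` and class `y`. -/
theorem count_census_mul_count [DecidableEq X] (G : Multigraph V) {f : V → X}
    {ρ : X → Multiset X} (hρ : ∀ p, G.received f p = ρ (f p)) (x y : X) :
    (census f).count x * (ρ x).count y = (census f).count y * (ρ y).count x := by
  have hlinks : ∀ x y, (census f).count x * (ρ x).count y =
      ∑ p with f p = x, ∑ q with f q = y, G.mult p q := by
    intro x y
    rw [count_census, ← smul_eq_mul, ← Finset.sum_const]
    refine Finset.sum_congr rfl fun p hp => ?_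
    rw [← G.count_received, hρ, (Finset.mem_filter.1 hp).2]
  rw [hlinks, hlinks, Finset.sum_comm]
  exact Finset.sum_congr rfl fun q _ => Finset.sum_congr rfl fun p _ => G.symm p q

theorem Connected.count_census_mul_eq [DecidableEq X] {G : Multigraph V} (hG : G.Connected)
    {G' : Multigraph V'} {f : V → X} {f' : V' → X} {ρ : X → Multiset X}
    (hρ : ∀ p, G.received f p = ρ (f p)) (hρ' : ∀ p, G'.received f' p = ρ (f' p)) (p q : V) :
    (census f').count (f p) * (census f).count (f q) =
      (census f).count (f p) * (census f').count (f q) := by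
  suffices h : {q | (census f').count (f p) * (census f).count (f q) =
      (census f).count (f p) * (census f').count (f q)} = Set.univ from
    Set.eq_univ_iff_forall.1 h q
  refine hG.eq_univ_of_forall_hears ⟨p, Nat.mul_comm _ _⟩ fun r q hrq hq => ?_
  obtain rfl | hlink := hrq
  · exact hq
  rw [Set.mem_ofPred_eq] at hq
  have hpos : 0 < (ρ (f r)).count (f q) := by
    rw [← hρ, Multiset.count_pos]
    exact mem_received.2 ⟨q, hlink, rfl⟩
  refine Nat.eq_of_mul_eq_mul_right hpos ?_
  calc (census f').count (f p) * (census f).count (f r) * (ρ (f r)).count (f q)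
      = (census f').count (f p) * (census f).count (f q) * (ρ (f q)).count (f r) := by
        rw [mul_assoc, G.count_census_mul_count hρ, mul_assoc]
    _ = (census f).count (f p) * (census f').count (f q) * (ρ (f q)).count (f r) := by
        rw [hq]
    _ = (census f).count (f p) * (census f').count (f r) * (ρ (f r)).count (f q) := by
        rw [mul_assoc, G'.count_census_mul_count hρ', mul_assoc]

theorem Connected.exists_nsmul_census_eq {G : Multigraph V} (hG : G.Connected)
    {G' : Multigraph V'} {f : V → X} {f' : V' → X} {ρ : X → Multiset X}
    (hρ : ∀ p, G.received f p = ρ (f p)) (hρ' : ∀ p, G'.received f' p = ρ (f' p))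
    (hrange : Set.range f = Set.range f') :
    ∃ a ≠ 0, ∃ b ≠ 0, a • census f = b • census f' := by
  classical
  obtain ⟨p⟩ := hG.nonempty
  have hp : f p ∈ Set.range f := Set.mem_range_self p
  refine ⟨(census f').count (f p), Multiset.count_ne_zero.2 (mem_census.2 (hrange ▸ hp)),
    (census f).count (f p), Multiset.count_ne_zero.2 (mem_census.2 hp), Multiset.ext.2 fun x => ?_⟩
  rw [Multiset.count_nsmul, Multiset.count_nsmul]
  by_cases hx : x ∈ Set.range f
  · obtain ⟨q, rfl⟩ := hx
    exact hG.count_census_mul_eq hρ hρ' p q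
  · have hx' : x ∉ Set.range f' := hrange ▸ hx
    rw [Multiset.count_eq_zero.2 (mt mem_census.1 hx),
      Multiset.count_eq_zero.2 (mt mem_census.1 hx'), mul_zero, mul_zero]

end Multigraph

end Census

/-! ### Views of a network -/

namespace LevelView

variable {I : Type u}

/-- The label of the bottom node. -/
def label {k : ℕ} : LevelView I (k + 1) → I
  | (x, _, _) => x

/-- The sub-view at the parent of the bottom node. -/
def parent {k : ℕ} : LevelView I (k + 1) → LevelView I k
  | (_, own, _) => own

/-- The sub-views at the sources of the red edges that enter the bottom node. -/
def redSources {k : ℕ} : LevelView I (k + 1) → Multiset (LevelView I k)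
  | (_, _, rec) => rec

/-- The sub-views whose bottom nodes lie in level `L_i`; they stand for the nodes of this level. -/
def subviews {i : ℕ} : (d : ℕ) → LevelView I (i + d) → Set (LevelView I i)
  | 0, W => {W}
  | d + 1, (_, own, rec) => {U | ∃ W ∈ own ::ₘ rec, U ∈ subviews d W}

theorem trim_self {k : ℕ} (W : LevelView I k) : trim le_rfl W = W := by
  simp [trim, Nat.leRec_self]

theorem trim_succ {k m : ℕ} (h : k ≤ m) (W : LevelView I (m + 1)) :
    trim (Nat.le_succ_of_le h) W = trim h (chop W) := by
  simp [trim, Nat.leRec_succ _ _ h]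

theorem trim_trim {j k m : ℕ} (hjk : j ≤ k) (hkm : k ≤ m) (W : LevelView I m) :
    trim hjk (trim hkm W) = trim (hjk.trans hkm) W := by
  induction m, hkm using Nat.le_induction with
  | base => rw [trim_self]
  | succ m hkm ih => rw [trim_succ hkm, ih, trim_succ (hjk.trans hkm)]

theorem trim_zero_extend {k : ℕ} (x : I) (own : LevelView I k) (rec : Multiset (LevelView I k)) :
    trim (k + 1).zero_le (extend x own rec) = (x : LevelView I 0) := by
  induction k with
  | zero => exact (trim_succ le_rfl _).trans (trim_self _)
  | succ k ih => exact (trim_succ (k + 1).zero_le _).trans (ih (chop own) (rec.map chop))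

theorem trim_succ_extend {j k : ℕ} (h : j ≤ k) (x : I) (own : LevelView I k)
    (rec : Multiset (LevelView I k)) :
    trim (Nat.succ_le_succ h) (extend x own rec) =
      extend x (trim h own) (rec.map (trim h)) := by
  induction k, h using Nat.le_induction with
  | base => rw [trim_self, trim_self, funext trim_self, Multiset.map_id']
  | succ k h ih =>
    calc trim _ (extend x own rec)
        = trim (Nat.succ_le_succ h) (extend x (chop own) (rec.map chop)) :=
          trim_succ (Nat.succ_le_succ h) _
      _ = extend x (trim h (chop own)) (rec.map fun W => trim h (chop W)) := by
          rw [ih, Multiset.map_map]; rfl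
      _ = extend x (trim _ own) (rec.map (trim _)) := by
          simp only [← trim_succ h]

end LevelView

/-- The view of each agent at the end of round `k` of a network in which all agents start from
their views of height `1`. -/
def networkView {V : Type v} [Fintype V] {I : Type u} (G : ℕ → Multigraph V) (input : V → I) :
    (k : ℕ) → V → LevelView I k
  | 0 => input
  | k + 1 => fun p => LevelView.extend (input p) (networkView G input k p)
      ((G k).received (networkView G input k) p)

section NetworkView

variable {V : Type v} [Fintype V] {I : Type u} {G : ℕ → Multigraph V} {input : V → I}

theorem mem_subviews_networkView_succ {i d : ℕ} {p : V} {U : LevelView I i} :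
    U ∈ LevelView.subviews (d + 1) (networkView G input (i + (d + 1)) p) ↔
      ∃ q, (G (i + d)).Hears p q ∧ U ∈ LevelView.subviews d (networkView G input (i + d) q) := by
  constructor
  · rintro ⟨W, hW, hU⟩
    obtain ⟨q, hq, rfl⟩ := Multigraph.mem_cons_received.1 hW
    exact ⟨q, hq, hU⟩
  · rintro ⟨q, hq, hU⟩
    exact ⟨_, Multigraph.mem_cons_received.2 ⟨q, hq, rfl⟩, hU⟩

theorem subviews_networkView_subset_range {i d : ℕ} {p : V} :
    LevelView.subviews d (networkView G input (i + d) p) ⊆ Set.range (networkView G input i) := by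
  intro U hU
  induction d generalizing p with
  | zero => exact ⟨p, (Set.mem_singleton_iff.1 hU).symm⟩
  | succ d ih =>
    obtain ⟨q, -, hq⟩ := mem_subviews_networkView_succ.1 hU
    exact ih hq

theorem subviews_networkView_eq_range (hG : ∀ t, (G t).Connected) {i d : ℕ}
    (hd : Fintype.card V ≤ d + 1) (p : V) :
    LevelView.subviews d (networkView G input (i + d) p) = Set.range (networkView G input i) := by
  refine subviews_networkView_subset_range.antisymm ?_
  rintro _ ⟨q, rfl⟩
  have hspread := Multigraph.eq_univ_of_spread (fun d => hG (i + d))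
    (R := fun d => {p | networkView G input i q ∈
      LevelView.subviews d (networkView G input (i + d) p)})
    ⟨q, Set.mem_singleton _⟩
    (fun d p r hpr hr => mem_subviews_networkView_succ.2 ⟨r, hpr, hr⟩) hd
  exact Set.eq_univ_iff_forall.1 hspread p

theorem parent_image_range_networkView (G : ℕ → Multigraph V) (input : V → I) (i : ℕ) :
    LevelView.parent '' Set.range (networkView G input (i + 1)) =
      Set.range (networkView G input i) :=
  (Set.range_comp _ _).symm

/-- Otherwise each of the first `n + 1` levels would have more nodes than the one above it, and the
last of them more than `n`. -/
theorem exists_injOn_parent_range_networkView [Nonempty V] (G : ℕ → Multigraph V)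
    (input : V → I) : ∃ i < Fintype.card V,
      Set.InjOn LevelView.parent (Set.range (networkView G input (i + 1))) := by
  by_contra! hbranch
  have hgrow : ∀ i ≤ Fintype.card V, i < (Set.range (networkView G input i)).ncard := by
    intro i hi
    induction i with
    | zero => exact (Set.ncard_pos (Set.finite_range _)).2 (Set.range_nonempty _)
    | succ i ih =>
      have hfin := Set.finite_range (networkView G input (i + 1))
      have himage := parent_image_range_networkView G input i
      have hle := Set.ncard_image_le (f := LevelView.parent) hfin
      have hne := mt (Set.injOn_of_ncard_image_eq · hfin) (hbranch i hi)
      rw [himage] at hle hne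
      exact (Nat.succ_le_of_lt (ih (Nat.le_of_succ_le hi))).trans_lt (lt_of_le_of_ne hle hne)
  have hle : (Set.range (networkView G input (Fintype.card V))).ncard ≤ Fintype.card V := by
    rw [← Set.image_univ, ← Nat.card_eq_fintype_card, ← Set.ncard_univ]
    exact Set.ncard_image_le
  exact (hgrow _ le_rfl).not_ge hle

theorem received_networkView_succ_eq {i : ℕ} {σ : LevelView I i → LevelView I (i + 1)}
    (hσ : ∀ p, σ (networkView G input i p) = networkView G input (i + 1) p) (p : V) :
    (G i).received (networkView G input (i + 1)) p =
      (networkView G input (i + 1) p).redSources.map σ := by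
  change _ = ((G i).received (networkView G input i) p).map σ
  rw [Multigraph.received_eq_map, Multigraph.received_eq_map (G i) (networkView G input i),
    Multiset.map_map]
  exact congrArg (Multiset.map · _) (funext hσ).symm

theorem map_label_census_networkView_succ (i : ℕ) :
    (census (networkView G input (i + 1))).map LevelView.label = census input :=
  Multiset.map_map _ _ _

theorem inputFrequency_eq_of_networkView_eq {V' : Type*} [Fintype V'] {G' : ℕ → Multigraph V'}
    {input' : V' → I} (hG : ∀ t, (G t).Connected) (hG' : ∀ t, (G' t).Connected) {k : ℕ}
    (hk : 2 * Fintype.card V ≤ k + 1) (hk' : 2 * Fintype.card V' ≤ k + 1) {p : V} {p' : V'}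
    (h : networkView G input k p = networkView G' input' k p') :
    inputFrequency input = inputFrequency input' := by
  have : Nonempty V := ⟨p⟩
  obtain ⟨i, hi, hinj⟩ := exists_injOn_parent_range_networkView G input
  obtain ⟨d, rfl⟩ : ∃ d, k = i + 1 + d := Nat.exists_eq_add_of_le (by omega)
  have hrange : Set.range (networkView G input (i + 1)) =
      Set.range (networkView G' input' (i + 1)) := by
    rw [← subviews_networkView_eq_range hG (d := d) (by omega) p, h,
      subviews_networkView_eq_range hG' (by omega)]
  have : Nonempty (LevelView I (i + 1)) := ⟨networkView G input (i + 1) p⟩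
  let σ := Function.invFunOn LevelView.parent (Set.range (networkView G input (i + 1)))
  have hσ : ∀ q, σ (networkView G input i q) = networkView G input (i + 1) q := fun q =>
    hinj.leftInvOn_invFunOn (Set.mem_range_self q)
  have hσ' : ∀ q, σ (networkView G' input' i q) = networkView G' input' (i + 1) q := fun q =>
    hinj.leftInvOn_invFunOn (hrange.ge (Set.mem_range_self q))
  obtain ⟨a, ha, b, hb, hab⟩ := (hG i).exists_nsmul_census_eq (G' := G' i)
    (ρ := fun W => W.redSources.map σ) (received_networkView_succ_eq hσ)
    (received_networkView_succ_eq hσ') hrange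
  refine inputFrequency_eq_of_nsmul_census_eq ha hb ?_
  rw [← map_label_census_networkView_succ (G := G) i,
    ← map_label_census_networkView_succ (G := G') i, ← Multiset.map_nsmul, hab, Multiset.map_nsmul]

end NetworkView

/-- `W` is the view of an agent of a connected network that starts without garbage and has input
frequencies `F`; the bound on its size ensures that `W` determines `F`. -/
def View.Explains {I : Type u} (W : View I) (F : I → ℚ) : Prop :=
  ∃ (V : Type v) (_ : Fintype V) (G : ℕ → Multigraph V) (input : V → I) (p : V),
    (∀ t, (G t).Connected) ∧ 2 * Fintype.card V ≤ W.height ∧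
      W.2 = networkView G input W.1 p ∧ F = inputFrequency input

theorem View.Explains.unique {I : Type u} {W : View I} {F F' : I → ℚ}
    (h : View.Explains.{u, v} W F) (h' : View.Explains.{u, v} W F') : F = F' := by
  obtain ⟨V, _, G, input, p, hG, hcard, hW, rfl⟩ := h
  obtain ⟨V', _, G', input', p', hG', hcard', hW', rfl⟩ := h'
  exact inputFrequency_eq_of_networkView_eq hG hG' hcard hcard' (hW.symm.trans hW')

/-! ### The update of views and flags -/

/-- A view with a flag: the contents of a well-formed memory. -/
abbrev FlaggedView (I : Type u) := View I × Bool

namespace FlaggedView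

variable {I : Type u}

/-- Twice the height minus the flag. It grows by one both when the height grows and the flag
becomes `1`, and when the height stays the same and the flag becomes `0`. -/
def progress (P : FlaggedView I) : ℕ :=
  2 * P.1.height - P.2.toNat

theorem progress_le_two_mul_height (P : FlaggedView I) : progress P ≤ 2 * P.1.height :=
  Nat.sub_le _ _

theorem two_mul_height_le_progress_add_one (P : FlaggedView I) :
    2 * P.1.height ≤ progress P + 1 := by
  have := P.2.toNat_le
  unfold progress
  omega

theorem index_le_of_progress_le {P Q : FlaggedView I} (h : progress P ≤ progress Q) :
    P.1.1 ≤ Q.1.1 := by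
  have hP : 2 * (P.1.1 + 1) ≤ progress P + 1 := two_mul_height_le_progress_add_one P
  have hQ : progress Q ≤ 2 * (Q.1.1 + 1) := progress_le_two_mul_height Q
  omega

/-- The selected pair. Minimizing the progress minimizes the height, and breaks ties in favor of
flag `1`. -/
noncomputable def select (P : FlaggedView I) (rec : Multiset (FlaggedView I)) : FlaggedView I :=
  Function.argminOn progress {Q | Q ∈ P ::ₘ rec} ⟨P, Multiset.mem_cons_self P rec⟩

variable {x : I} {P Q : FlaggedView I} {rec : Multiset (FlaggedView I)}

theorem select_mem : select P rec ∈ P ::ₘ rec :=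
  Function.argminOn_mem progress {Q | Q ∈ P ::ₘ rec} _

theorem progress_select_le (h : Q ∈ P ::ₘ rec) : progress (select P rec) ≤ progress Q :=
  Function.argminOn_le progress {Q | Q ∈ P ::ₘ rec} h

theorem index_select_le (h : Q ∈ P ::ₘ rec) : (select P rec).1.1 ≤ Q.1.1 :=
  index_le_of_progress_le (progress_select_le h)

/-- The own view and the received ones, chopped to minimum height and joined. -/
noncomputable def join (x : I) (P : FlaggedView I) (rec : Multiset (FlaggedView I)) :
    LevelView I ((select P rec).1.1 + 1) :=
  LevelView.extend x (LevelView.trim (index_select_le (Multiset.mem_cons_self P rec)) P.1.2)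
    (rec.pmap (fun Q (h : (select P rec).1.1 ≤ Q.1.1) => LevelView.trim h Q.1.2)
      fun _ hQ => index_select_le (Multiset.mem_cons_of_mem hQ))

/-- The new pair of an agent with input `x` and pair `P` that receives the pairs in `rec`. -/
noncomputable def next (x : I) (P : FlaggedView I) (rec : Multiset (FlaggedView I)) :
    FlaggedView I :=
  match (select P rec).2 with
  | false => (⟨(select P rec).1.1 + 1, join x P rec⟩, true)
  | true => (⟨(select P rec).1.1, (join x P rec).chop⟩, false)

theorem progress_next : progress (next x P rec) = progress (select P rec) + 1 := by
  unfold next progress View.height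
  cases (select P rec).2 <;> simp only [Bool.toNat_true, Bool.toNat_false] <;> omega

theorem index_next_le : (next x P rec).1.1 ≤ (select P rec).1.1 + 1 := by
  unfold next
  cases (select P rec).2
  · exact le_rfl
  · exact Nat.le_succ _

theorem trim_next {j : ℕ} (hj : j ≤ (next x P rec).1.1) :
    LevelView.trim hj (next x P rec).1.2 =
      LevelView.trim (hj.trans index_next_le) (join x P rec) := by
  suffices h : ∀ hj', LevelView.trim hj (next x P rec).1.2 = LevelView.trim hj' (join x P rec) from
    h _
  revert hj
  unfold next
  cases (select P rec).2 with
  | false => exact fun _ _ => rfl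
  | true => exact fun hj _ => (LevelView.trim_succ hj _).symm

theorem trim_zero_next : LevelView.trim (Nat.zero_le _) (next x P rec).1.2 = (x : LevelView I 0) :=
  (trim_next _).trans (LevelView.trim_zero_extend _ _ _)

theorem le_index_of_succ_le_index_next {j : ℕ} (hj : j + 1 ≤ (next x P rec).1.1)
    (hQ : Q ∈ P ::ₘ rec) : j ≤ Q.1.1 :=
  (Nat.le_of_succ_le_succ (hj.trans index_next_le)).trans (index_select_le hQ)

theorem trim_succ_next {j : ℕ} (hj : j + 1 ≤ (next x P rec).1.1) :
    LevelView.trim hj (next x P rec).1.2 = LevelView.extend x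
      (LevelView.trim (le_index_of_succ_le_index_next hj (Multiset.mem_cons_self P rec)) P.1.2)
      (rec.pmap (fun Q (h : j ≤ Q.1.1) => LevelView.trim h Q.1.2)
        fun _ hQ => le_index_of_succ_le_index_next hj (Multiset.mem_cons_of_mem hQ)) := by
  have hjoin : j ≤ (select P rec).1.1 := Nat.le_of_succ_le_succ (hj.trans index_next_le)
  rw [trim_next, join, LevelView.trim_succ_extend hjoin, LevelView.trim_trim, Multiset.map_pmap]
  exact congrArg _ (Multiset.pmap_congr _ fun _ _ _ _ => LevelView.trim_trim _ _ _)

/-! ### Stabilization -/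

variable {V : Type v} [Fintype V] {G : ℕ → Multigraph V} {input : V → I} {P₀ : V → FlaggedView I}

/-- The pair of every agent at the end of round `t`, if the initial pairs are `P₀`. -/
noncomputable def run (G : ℕ → Multigraph V) (input : V → I) (P₀ : V → FlaggedView I) :
    ℕ → V → FlaggedView I
  | 0 => P₀
  | t + 1 => fun p => next (input p) (run G input P₀ t p) ((G t).received (run G input P₀ t) p)

theorem exists_progress_run_succ_eq (t : ℕ) (p : V) :
    ∃ q, progress (run G input P₀ (t + 1) p) = progress (run G input P₀ t q) + 1 := by
  obtain ⟨q, -, hq⟩ := Multigraph.mem_cons_received.1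
    (select_mem (P := run G input P₀ t p) (rec := (G t).received (run G input P₀ t) p))
  exact ⟨q, hq ▸ progress_next⟩

theorem progress_run_succ_le {t : ℕ} {p q : V} (h : (G t).Hears p q) :
    progress (run G input P₀ (t + 1) p) ≤ progress (run G input P₀ t q) + 1 :=
  progress_next.trans_le
    (Nat.succ_le_succ (progress_select_le (Multigraph.mem_cons_received.2 ⟨q, h, rfl⟩)))

theorem le_progress_run {c : ℕ} (hc : ∀ p, c ≤ progress (P₀ p)) (t : ℕ) (p : V) :
    c + t ≤ progress (run G input P₀ t p) := by
  induction t generalizing p with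
  | zero => exact hc p
  | succ t ih =>
    obtain ⟨q, hq⟩ := exists_progress_run_succ_eq t p
    exact hq ▸ Nat.succ_le_succ (ih q)

theorem progress_run_le (hG : ∀ t, (G t).Connected) {c : ℕ} {q : V} (hq : progress (P₀ q) ≤ c)
    {t : ℕ} (ht : Fintype.card V ≤ t + 1) (p : V) : progress (run G input P₀ t p) ≤ c + t := by
  have hspread := Multigraph.eq_univ_of_spread hG
    (R := fun t => {p | progress (run G input P₀ t p) ≤ c + t}) ⟨q, hq⟩
    (fun t p q hpq hq => (progress_run_succ_le hpq).trans (Nat.succ_le_succ hq)) ht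
  exact Set.eq_univ_iff_forall.1 hspread p

theorem le_two_mul_height_run {m : ℕ} (hm : ∀ p, m ≤ (P₀ p).1.height) (t : ℕ) (p : V) :
    2 * m + t ≤ 2 * (run G input P₀ t p).1.height + 1 := by
  have hprogress : ∀ p, 2 * m - 1 ≤ progress (P₀ p) := fun p => by
    have := hm p
    have := two_mul_height_le_progress_add_one (P₀ p)
    omega
  have hrun := le_progress_run (G := G) (input := input) hprogress t p
  have := progress_le_two_mul_height (run G input P₀ t p)
  omega

theorem two_mul_height_run_le (hG : ∀ t, (G t).Connected) {q : V} {t : ℕ}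
    (ht : Fintype.card V ≤ t + 1) (p : V) :
    2 * (run G input P₀ t p).1.height ≤ 2 * (P₀ q).1.height + t + 1 :=
  (two_mul_height_le_progress_add_one _).trans
    (Nat.succ_le_succ (progress_run_le hG (progress_le_two_mul_height (P₀ q)) ht p))

/-- After round `s + 1` all labels of the bottom nodes are genuine, and from then on every round
adds a genuine level. -/
theorem trim_run {s t j : ℕ} (ht : t = s + 1 + j) {p : V} (hj : j ≤ (run G input P₀ t p).1.1) :
    LevelView.trim hj (run G input P₀ t p).1.2 =
      networkView (fun i => G (s + 1 + i)) input j p := by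
  subst ht
  induction j generalizing p with
  | zero => exact trim_zero_next
  | succ j ih =>
    exact (trim_succ_next hj).trans (congrArg₂ (LevelView.extend (input p)) (ih _)
      (Multigraph.pmap_received _ fun _ h => ih h))

theorem explains_run_of_height_le (hG : ∀ t, (G t).Connected) {t : ℕ} {p : V}
    (hcard : 2 * Fintype.card V ≤ (run G input P₀ t p).1.height)
    (ht : (run G input P₀ t p).1.height ≤ t) :
    View.Explains.{u, v} (run G input P₀ t p).1 (inputFrequency input) := by
  obtain ⟨s, hs⟩ := Nat.exists_eq_add_of_le' ht
  have hview := trim_run (hs.trans (Nat.succ_add_eq_add_succ s _).symm) le_rfl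
  exact ⟨V, inferInstance, fun i => G (s + 1 + i), input, p, fun i => hG _, hcard,
    (LevelView.trim_self _).symm.trans hview, rfl⟩

theorem explains_run (hG : ∀ t, (G t).Connected) {q : V}
    (hq : ∀ p, (P₀ q).1.height ≤ (P₀ p).1.height) {t : ℕ}
    (ht : max (4 * Fintype.card V - 2 * (P₀ q).1.height) (2 * (P₀ q).1.height) ≤ t) (p : V) :
    View.Explains.{u, v} (run G input P₀ t p).1 (inputFrequency input) := by
  have hlower := le_two_mul_height_run (G := G) (input := input) hq t p
  have hupper := two_mul_height_run_le (input := input) (P₀ := P₀) hG (q := q) (t := t)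
    (by omega) p
  exact explains_run_of_height_le hG (by omega) (by omega)

end FlaggedView

/-! ### The algorithm -/

/-- The view-chopping algorithm, which outputs the input frequencies that explain its view. -/
noncomputable def viewChopping (I : Type u) (J : Type w) :
    Algorithm I (Memory I J) (View I × Bool) (I → ℚ) where
  send x s := s.reset x
  step x s rec := .inl (FlaggedView.next x (s.reset x) rec)
  out x s := Classical.epsilon (View.Explains.{u, v} (s.reset x).1)

namespace viewChopping

variable {I : Type u} {J : Type w}

theorem chopsViews : (viewChopping.{u, v, w} I J).ChopsViews :=
  ⟨fun _ _ => rfl, fun x s rec =>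
    let S := FlaggedView.select (s.reset x) rec
    ⟨S.1, S.2, FlaggedView.select_mem, FlaggedView.index_select_le (Multiset.mem_cons_self _ _),
      fun _ hP => FlaggedView.index_select_le (Multiset.mem_cons_of_mem hP), rfl⟩⟩

theorem reset_run {V : Type v} [Fintype V] (G : ℕ → Multigraph V) (input : V → I)
    (s₀ : V → Memory I J) (t : ℕ) (p : V) :
    ((viewChopping.{u, v, w} I J).run G input s₀ t p).reset (input p) =
      FlaggedView.run G input (fun q => (s₀ q).reset (input q)) t p := by
  induction t generalizing p with
  | zero => rfl
  | succ t ih =>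
    rw [FlaggedView.run, ← funext ih]
    rfl

theorem out_eq {x : I} {s : Memory I J} {F : I → ℚ} (h : View.Explains.{u, v} (s.reset x).1 F) :
    (viewChopping.{u, v, w} I J).out x s = F :=
  (Classical.epsilon_spec (p := View.Explains.{u, v} (s.reset x).1) ⟨F, h⟩).unique h

end viewChopping

theorem Memory.height_reset {I : Type u} {J : Type w} (x : I) (s : Memory I J) :
    (s.reset x).1.height = max s.garbage 1 := by
  rcases s with ⟨W, _⟩ | _
  · exact (max_eq_left W.1.succ_pos).symm
  · rfl

theorem theorem2 (I : Type u) (J : Type w) :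
    ∃ A : Algorithm I (Memory I J) (View I × Bool) (I → ℚ),
      A.ChopsViews ∧
      ∀ (V : Type v) [Fintype V] (G : ℕ → Multigraph V) (input : V → I) (s₀ : V → Memory I J),
        (∀ t, (G t).Connected) →
        ∀ t : ℕ, max (4 * Fintype.card V - 2 * ⨅ p, (s₀ p).garbage) (2 * ⨅ p, (s₀ p).garbage) ≤ t →
          ∀ p, A.out (input p) (A.run G input s₀ t p) = inputFrequency input := by
  refine ⟨viewChopping.{u, v, w} I J, viewChopping.chopsViews, fun V _ G input s₀ hG t ht p => ?_⟩
  have : Nonempty V := ⟨p⟩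
  obtain ⟨q, hq⟩ := exists_eq_ciInf_of_finite (f := fun p => (s₀ p).garbage)
  have hmin : ∀ r, (s₀ q).garbage ≤ (s₀ r).garbage := fun r =>
    hq.trans_le (ciInf_le (OrderBot.bddBelow _) r)
  refine viewChopping.out_eq ?_
  rw [viewChopping.reset_run]
  refine FlaggedView.explains_run (q := q) hG (fun r => ?_) ?_ p
  · simp only [Memory.height_reset]
    exact max_le_max_right 1 (hmin r)
  · have hcard : 0 < Fintype.card V := Fintype.card_pos
    rw [← hq] at ht
    simp only [Memory.height_reset]
    omega
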